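/- Write $\mathbb R^+=[0,\infty)$. An algebra weight on $\mathbb R^+$ is a positive Borel function $w$ on $\mathbb R^+$ such that $w$ and $1/w$ are locally bounded, $w$ is right continuous, $w(t+s)\le w(t)w(s)$ for all $t,s\in\mathbb R^+$, and $w(0)=1$. Let $\omega=(\omega_n)$ be an increasing sequence of algebra weights on $\mathbb R^+$ such that, for every $n$, (a) $\omega_n(t)\to\infty$ as $t\to\infty$, (b) $\lim_{t\to\infty}\omega_n(t)^{1/t}=1$, (c) $\sup_{t\in\mathbb R^+}\omega_{n+1}(t)/\omega_n(t)=\infty$. Let $L^1(\omega_n)$ be the space of (equivalence classes of) measurable functions $f:\mathbb R^+\to\mathbb C$ with $\|f\|_n=\int_0^\infty|f(t)|\omega_n(t)\,dt<\infty$, and let $A(\omega)=\bigcap_n L^1(\omega_n)$, with the topology defined by the norms $\|\cdot\|_n$ and the convolution product $(f*g)(t)=\int_0^t f(s)g(t-s)\,ds$; this is a Fréchet algebra. A derivation on $A(\omega)$ is a linear map $D:A(\omega)\to A(\omega)$ with $D(f*g)=f*Dg+Df*g$ for all $f,g\in A(\omega)$. It is weakly compact if there is a neighbourhood $U$ of $0$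 in $A(\omega)$ such that $D(U)$ is relatively compact in the weak topology of $A(\omega)$. **Theorem.** There are no non-zero weakly compact derivations on $A(\omega)$: if $D$ is a weakly compact derivation on $A(\omega)$, then $D=0$. -/

import Mathlib

open MeasureTheory Set Filter Topology

/-- An algebra weight on `ℝ⁺ = [0, ∞)`: a positive Borel function `w`, right continuous, with `w` and
`1 / w` locally bounded, submultiplicative, and with `w 0 = 1`.  Only the values of `w` on `[0, ∞)`
matter. -/
structure IsAlgebraWeight (w : ℝ → ℝ) : Prop where
  pos : ∀ t, 0 ≤ t → 0 < w t
  measurable : Measurable (fun t : Ici (0 : ℝ) => w t)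
  locallyBounded : ∀ T : ℝ, BddAbove (w '' Icc 0 T)
  inv_locallyBounded : ∀ T : ℝ, BddAbove ((fun t => 1 / w t) '' Icc 0 T)
  rightContinuous : ∀ t, 0 ≤ t → ContinuousWithinAt w (Ici t) t
  submul : ∀ t s, 0 ≤ t → 0 ≤ s → w (t + s) ≤ w t * w s
  map_zero : w 0 = 1

/-- An increasing sequence `ω = (ω n)` of algebra weights on `ℝ⁺` satisfying
(a) `ω n t → ∞` as `t → ∞`,
(b) `(ω n t) ^ (1 / t) → 1` as `t → ∞`,
(c) `sup_{t ≥ 0} ω (n + 1) t / ω n t = ∞`, for every `n`. -/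
structure WeightSequence where
  /-- the `n`-th weight -/
  weight : ℕ → ℝ → ℝ
  isAlgebraWeight : ∀ n, IsAlgebraWeight (weight n)
  increasing : ∀ n t, 0 ≤ t → weight n t ≤ weight (n + 1) t
  tendsto_atTop : ∀ n, Tendsto (weight n) atTop atTop
  tendsto_root : ∀ n, Tendsto (fun t : ℝ => weight n t ^ (1 / t)) atTop (𝓝 1)
  unbounded_ratio : ∀ n, ¬ BddAbove ((fun t => weight (n + 1) t / weight n t) '' Ici 0)

/-- Lebesgue measure on `ℝ⁺ = [0, ∞)`. -/
noncomputable abbrev volPos : Measure ℝ := volume.restrict (Ici 0)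

/-- The weighted space `L¹(w)`: classes (modulo equality almost everywhere on `ℝ⁺`) of measurable
functions `f : ℝ⁺ → ℂ` for which `f w` is integrable on `ℝ⁺`. -/
def weightedL1 (w : ℝ → ℝ) : Submodule ℂ (ℝ →ₘ[volPos] ℂ) where
  carrier := {f | Integrable (fun t => f t * (w t : ℂ)) volPos}
  zero_mem' := by
    refine (integrable_zero ℝ ℂ volPos).congr ?_
    filter_upwards [AEEqFun.coeFn_zero (α := ℝ) (β := ℂ) (μ := volPos)] with t ht
    simp [ht]
  add_mem' := by
    intro f g hf hg
    refine (Integrable.add hf hg).congr ?_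
    filter_upwards [AEEqFun.coeFn_add f g] with t ht
    simp [ht, add_mul]
  smul_mem' := by
    intro c f hf
    refine (Integrable.const_mul hf c).congr ?_
    filter_upwards [AEEqFun.coeFn_smul c f] with t ht
    simp [ht, mul_assoc]

/-- The space `A(ω) = ⋂ n, L¹(ω n)`. -/
def FrechetA (ω : WeightSequence) : Type :=
  ↥(⨅ n, weightedL1 (ω.weight n) : Submodule ℂ (ℝ →ₘ[volPos] ℂ))

/-- The convolution product `(f * g)(t) = ∫₀ᵗ f(s) g(t - s) ds` on `ℝ⁺`. -/
noncomputable def convPos (f g : ℝ → ℂ) : ℝ → ℂ :=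
  fun t => ∫ s in (0 : ℝ)..t, f s * g (t - s)

theorem volPos_eq : volPos = volume.restrict (Ioi (0 : ℝ)) :=
  (restrict_Ioi_eq_restrict_Ici).symm

theorem convPos_eq {f g : ℝ → ℂ} {t : ℝ} (ht : 0 < t) :
    convPos f g t = posConvolution f g (ContinuousLinearMap.mul ℝ ℂ) volume t := by
  simp [posConvolution, convPos, ht]

theorem aestronglyMeasurable_convPos {f g : ℝ → ℂ} (hf : AEStronglyMeasurable f volPos)
    (hg : AEStronglyMeasurable g volPos) : AEStronglyMeasurable (convPos f g) volPos := by
  rw [volPos_eq] at *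
  rw [← aestronglyMeasurable_indicator_iff measurableSet_Ioi] at hf hg
  have h := (hf.convolution_integrand (μ := volume) (ContinuousLinearMap.mul ℝ ℂ)
    hg).integral_prod_right'
  refine (h.mono_measure Measure.restrict_le_self).congr ?_
  filter_upwards [ae_restrict_mem measurableSet_Ioi] with t ht
  have h2 := congrFun (posConvolution_eq_convolution_indicator f g (ContinuousLinearMap.mul ℝ ℂ)
    volume) t
  rw [convPos_eq ht, h2]
  rfl

theorem integrable_convPos_mul {w : ℝ → ℝ} (hw : IsAlgebraWeight w) {f g : ℝ → ℂ}
    (hf : AEStronglyMeasurable f volPos) (hg : AEStronglyMeasurable g volPos)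
    (hfw : Integrable (fun t => f t * (w t : ℂ)) volPos)
    (hgw : Integrable (fun t => g t * (w t : ℂ)) volPos) :
    Integrable (fun t => convPos f g t * (w t : ℂ)) volPos := by
  have hm := aestronglyMeasurable_convPos hf hg
  have hwm : AEStronglyMeasurable (fun t => (w t : ℂ)) volPos := by
    have h1 : AEMeasurable w volPos :=
      aemeasurable_restrict_of_measurable_subtype measurableSet_Ici hw.measurable
    exact (Complex.measurable_ofReal.comp_aemeasurable h1).aestronglyMeasurable
  have hF := hfw.norm
  have hG := hgw.norm
  have hmeas := hm.mul hwm
  rw [volPos_eq] at hF hG hmeas ⊢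
  have hFG := integrable_posConvolution (μ := volume) (ν := volume) hF hG
    (ContinuousLinearMap.mul ℝ ℝ)
  have hex := ((integrable_indicator_iff measurableSet_Ioi).2 hF).ae_convolution_exists (μ := volume)
    (ContinuousLinearMap.mul ℝ ℝ) ((integrable_indicator_iff measurableSet_Ioi).2 hG)
  refine (hFG.mono_measure Measure.restrict_le_self).mono' hmeas ?_
  filter_upwards [ae_restrict_mem measurableSet_Ioi, ae_restrict_of_ae hex] with t ht htex
  have ht0 : (0 : ℝ) < t := ht
  rw [posConvolution, indicator_of_mem ht, convPos, norm_mul, Complex.norm_real,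
    intervalIntegral.integral_of_le ht0.le, intervalIntegral.integral_of_le ht0.le,
    integral_Ioc_eq_integral_Ioo, integral_Ioc_eq_integral_Ioo]
  refine (mul_le_mul_of_nonneg_right (norm_integral_le_integral_norm _) (norm_nonneg _)).trans ?_
  rw [← integral_mul_const]
  refine integral_mono_of_nonneg (Eventually.of_forall fun s => by positivity) ?_ ?_
  · have h2 : IntegrableOn (fun s => (ContinuousLinearMap.mul ℝ ℝ)
        ((Ioi (0 : ℝ)).indicator (fun t => ‖f t * (w t : ℂ)‖) s)
        ((Ioi (0 : ℝ)).indicator (fun t => ‖g t * (w t : ℂ)‖) (t - s))) (Ioo 0 t) volume :=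
      Integrable.integrableOn htex
    refine h2.congr_fun ?_ measurableSet_Ioo
    intro s hs
    have h3 : t - s ∈ Ioi (0 : ℝ) := sub_pos.2 hs.2
    simp only [indicator_of_mem (show s ∈ Ioi (0 : ℝ) from hs.1), indicator_of_mem h3]
  · filter_upwards [ae_restrict_mem measurableSet_Ioo] with s hs
    have h1 : 0 ≤ s := hs.1.le
    have h2 : 0 ≤ t - s := (sub_pos.2 hs.2).le
    have h3 : w t ≤ w s * w (t - s) := by simpa using hw.submul s (t - s) h1 h2
    simp only [ContinuousLinearMap.mul_apply', norm_mul, Complex.norm_real, Real.norm_eq_abs,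
      abs_of_pos (hw.pos t ht0.le), abs_of_pos (hw.pos s h1), abs_of_pos (hw.pos (t - s) h2)]
    calc ‖f s‖ * ‖g (t - s)‖ * w t ≤ ‖f s‖ * ‖g (t - s)‖ * (w s * w (t - s)) := by gcongr
      _ = ‖f s‖ * w s * (‖g (t - s)‖ * w (t - s)) := by ring

namespace FrechetA

variable {ω : WeightSequence}

noncomputable instance : AddCommGroup (FrechetA ω) :=
  inferInstanceAs (AddCommGroup
    ↥(⨅ n, weightedL1 (ω.weight n) : Submodule ℂ (ℝ →ₘ[volPos] ℂ)))

noncomputable instance : Module ℂ (FrechetA ω) :=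
  inferInstanceAs (Module ℂ
    ↥(⨅ n, weightedL1 (ω.weight n) : Submodule ℂ (ℝ →ₘ[volPos] ℂ)))

/-- The underlying class of functions of an element of `A(ω)`. -/
def toAEEqFun (f : FrechetA ω) : ℝ →ₘ[volPos] ℂ := f.1

theorem integrable (f : FrechetA ω) (n : ℕ) :
    Integrable (fun t => f.toAEEqFun t * (ω.weight n t : ℂ)) volPos :=
  (Submodule.mem_iInf _).1 f.2 n

/-- The product of `A(ω)` is convolution. -/
noncomputable instance : Mul (FrechetA ω) where
  mul f g := ⟨AEEqFun.mk (convPos f.toAEEqFun g.toAEEqFun)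
      (aestronglyMeasurable_convPos f.toAEEqFun.aestronglyMeasurable
        g.toAEEqFun.aestronglyMeasurable), by
    refine (Submodule.mem_iInf _).2 fun n => ?_
    refine (integrable_convPos_mul (ω.isAlgebraWeight n) f.toAEEqFun.aestronglyMeasurable
      g.toAEEqFun.aestronglyMeasurable (f.integrable n) (g.integrable n)).congr ?_
    filter_upwards [AEEqFun.coeFn_mk (convPos f.toAEEqFun g.toAEEqFun)
      (aestronglyMeasurable_convPos f.toAEEqFun.aestronglyMeasurable
        g.toAEEqFun.aestronglyMeasurable)] with t ht
    rw [ht]⟩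

theorem integrable_norm (f : FrechetA ω) (n : ℕ) :
    Integrable (fun t => ‖f.toAEEqFun t‖ * ω.weight n t) volPos := by
  refine (f.integrable n).norm.congr ?_
  filter_upwards [ae_restrict_mem measurableSet_Ici] with t ht
  rw [norm_mul, Complex.norm_real, Real.norm_of_nonneg ((ω.isAlgebraWeight n).pos t ht).le]

/-- The norms `‖f‖ₙ = ∫₀^∞ |f(t)| ωₙ(t) dt` on `A(ω)`. -/
noncomputable def norms (ω : WeightSequence) : SeminormFamily ℂ (FrechetA ω) ℕ := fun n =>
  Seminorm.of (fun f => ∫ t in Ici (0 : ℝ), ‖f.toAEEqFun t‖ * ω.weight n t)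
    (by
      intro f g
      rw [← integral_add (f.integrable_norm n) (g.integrable_norm n)]
      refine integral_mono_ae ((f + g).integrable_norm n)
        ((f.integrable_norm n).add (g.integrable_norm n)) ?_
      filter_upwards [AEEqFun.coeFn_add f.toAEEqFun g.toAEEqFun,
        ae_restrict_mem measurableSet_Ici] with t ht ht0
      have h : (f + g).toAEEqFun t = f.toAEEqFun t + g.toAEEqFun t := ht
      have hp := (ω.isAlgebraWeight n).pos t ht0
      simp only [h, ← add_mul]
      gcongr
      exact norm_add_le _ _)
    (by
      intro c f
      rw [← integral_const_mul]
      refine integral_congr_ae ?_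
      filter_upwards [AEEqFun.coeFn_smul c f.toAEEqFun] with t ht
      have h : (c • f).toAEEqFun t = c • f.toAEEqFun t := ht
      simp only [h, norm_smul, mul_assoc])

/-- The Fréchet topology of `A(ω)`, given by the sequence of norms `‖·‖ₙ`. -/
noncomputable instance : TopologicalSpace (FrechetA ω) :=
  (norms ω).moduleFilterBasis.topology

end FrechetA

/-- A derivation on an algebra `A`: a linear map (continuity is not required) with
`D (a * b) = a * D b + D a * b`. -/
def IsDerivation {A : Type*} [AddCommGroup A] [Module ℂ A] [Mul A] (D : A →ₗ[ℂ] A) : Prop :=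
  ∀ a b : A, D (a * b) = a * D b + D a * b

/-- A linear map between topological vector spaces is weakly compact if it maps some neighbourhood
of `0` to a weakly relatively compact set. -/
def IsWeaklyCompactMap {E F : Type*} [AddCommGroup E] [Module ℂ E] [TopologicalSpace E]
    [AddCommGroup F] [Module ℂ F] [TopologicalSpace F] (T : E →ₗ[ℂ] F) : Prop :=
  ∃ U ∈ 𝓝 (0 : E), IsCompact (closure (toWeakSpace ℂ F '' (T '' U)))

/-! The argument is the Singer–Wermer theorem applied to a single norm. A weakly relatively compact
set is bounded in every norm, and since the norms increase, the neighbourhood in the definition of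
weak compactness contains a ball of some ‖·‖ₙ. Measuring the image in that same norm gives ‖D f‖ₙ ≤
K ‖f‖ₙ (`exists_norms_le_of_isWeaklyCompactMap`), so D is a bounded derivation for one
submultiplicative norm.

If φ is a bounded character and φ(a) = 0, then Leibniz gives φ(Dᵐ(aᵐ)) = m! φ(Da)ᵐ, whereas
boundedness gives at most C (K‖a‖)ᵐ; the factorial forces φ(Da) = 0
(`IsDerivation.map_apply_eq_zero`). Hence φ ∘ D = 0 for every bounded character.

The Fourier transforms at real frequencies are such characters (`fourierFunctional_mul`,
`norm_fourierFunctional_le`), and they separate points (`eq_zero_of_fourierFunctional_eq_zero`), so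
D = 0. -/

/-- Right-nested powers: `nestedPow a k` is the product `a * (a * (⋯ * a))` of `k + 1` factors. -/
def nestedPow {A : Type*} [Mul A] (a : A) : ℕ → A
  | 0 => a
  | k + 1 => a * nestedPow a k

/-! ### Bounded derivations and characters (Singer–Wermer) -/

section Derivation

variable {A : Type*} [AddCommGroup A] [Module ℂ A] [Mul A] {D : A →ₗ[ℂ] A}

theorem IsDerivation.iterate_mul (hD : IsDerivation D) (a b : A) (n : ℕ) :
    D^[n] (a * b) =
      ∑ ij ∈ Finset.HasAntidiagonal.antidiagonal n, n.choose ij.1 • (D^[ij.1] a * D^[ij.2] b) := by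
  induction n with
  | zero => simp
  | succ n ih =>
    rw [Finset.sum_antidiagonal_choose_succ_nsmul (fun i j => D^[i] a * D^[j] b) n,
      Function.iterate_succ_apply', ih, map_sum, ← Finset.sum_add_distrib]
    refine Finset.sum_congr rfl fun ij hij => ?_
    rw [map_nsmul, hD, nsmul_add, Function.iterate_succ_apply', Function.iterate_succ_apply',
      ← Nat.choose_symm_of_eq_add (Finset.HasAntidiagonal.mem_antidiagonal.1 hij).symm]

variable {φ : A →ₗ[ℂ] ℂ}

/-- A term of the Leibniz expansion survives φ only if each of the k + 1 factors is differentiated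
at least once. With k derivatives or fewer this is impossible; with k + 1, each factor gets exactly
one, in (k + 1)! orders. Nested powers are used because the product is not assumed associative. -/
theorem IsDerivation.map_iterate_nestedPow (hD : IsDerivation D)
    (hφ : ∀ a b, φ (a * b) = φ a * φ b) {a : A} (ha : φ a = 0) (k : ℕ) :
    (∀ j ≤ k, φ (D^[j] (nestedPow a k)) = 0) ∧
      φ (D^[k + 1] (nestedPow a k)) = (k + 1).factorial * φ (D a) ^ (k + 1) := by
  -- The term with no derivative on `a` vanishes since φ(a) = 0, hence the shift of the first index.
  have hmul : ∀ b j, φ (D^[j + 1] (a * b)) = ∑ ij ∈ Finset.HasAntidiagonal.antidiagonal j,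
      ((j + 1).choose (ij.1 + 1) : ℂ) * (φ (D^[ij.1 + 1] a) * φ (D^[ij.2] b)) := by
    intro b j
    rw [hD.iterate_mul, map_sum, Finset.Nat.sum_antidiagonal_succ]
    simp [hφ, ha]
  induction k with
  | zero => simp [nestedPow, ha]
  | succ k ih =>
    constructor
    · rintro (_ | j) hj
      · simp [nestedPow, hφ, ha]
      · rw [nestedPow, hmul]
        refine Finset.sum_eq_zero fun ij hij => ?_
        have := Finset.HasAntidiagonal.mem_antidiagonal.1 hij
        rw [ih.1 ij.2 (by omega)]
        simp
    -- Only one derivative may fall on the new factor; the binomial coefficient k + 2 turns (k + 1)!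
    -- into (k + 2)!.
    · rw [nestedPow, hmul, Finset.sum_eq_single (0, k + 1)]
      · rw [ih.2, Nat.factorial_succ (k + 1)]
        simp
        ring
      · intro ij hij hne
        have h := Finset.HasAntidiagonal.mem_antidiagonal.1 hij
        have : ij.2 ≤ k := by
          by_contra hk
          exact hne (Prod.ext (by simp; omega) (by simp; omega))
        rw [ih.1 ij.2 this]
        simp
      · simp

theorem nestedPow_le (p : Seminorm ℂ A) (hp : ∀ a b, p (a * b) ≤ p a * p b) (a : A) (k : ℕ) :
    p (nestedPow a k) ≤ p a ^ (k + 1) := by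
  induction k with
  | zero => simp [nestedPow]
  | succ k ih =>
    rw [pow_succ' (p a) (k + 1)]
    exact (hp _ _).trans (mul_le_mul_of_nonneg_left ih (apply_nonneg p a))

/-- A bounded derivation maps into the kernel of every bounded multiplicative functional. -/
theorem IsDerivation.map_apply_eq_zero (hD : IsDerivation D)
    (hφ : ∀ a b, φ (a * b) = φ a * φ b) (p : Seminorm ℂ A) (hp : ∀ a b, p (a * b) ≤ p a * p b)
    {K C : ℝ} (hK : ∀ a, p (D a) ≤ K * p a) (hC : ∀ a, ‖φ a‖ ≤ C * p a) (a : A) :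
    φ (D a) = 0 := by
  wlog hK0 : 0 ≤ K generalizing K
  · exact this (K := max K 0) (fun a => (hK a).trans
      (mul_le_mul_of_nonneg_right (le_max_left _ _) (apply_nonneg p a))) (le_max_right _ _)
  wlog hC0 : 0 ≤ C generalizing C
  · exact this (C := max C 0) (fun a => (hC a).trans
      (mul_le_mul_of_nonneg_right (le_max_left _ _) (apply_nonneg p a))) (le_max_right _ _)
  have hiter : ∀ n a, p (D^[n] a) ≤ K ^ n * p a := by
    intro n
    induction n with
    | zero => simp
    | succ n ih =>
      intro a
      rw [Function.iterate_succ_apply, pow_succ, mul_assoc]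
      exact (ih _).trans (mul_le_mul_of_nonneg_left (hK a) (by positivity))
  have key : ∀ a, φ a = 0 → φ (D a) = 0 := by
    intro a ha
    by_contra hne
    have hb : ∀ n : ℕ, ‖φ (D a)‖ ^ (n + 1) ≤ C * ((K * p a) ^ (n + 1) / (n + 1).factorial) := by
      intro n
      rw [← mul_div_assoc, le_div_iff₀ (by positivity)]
      have h := hC (D^[n + 1] (nestedPow a n))
      rw [(hD.map_iterate_nestedPow hφ ha n).2, norm_mul, norm_pow, Complex.norm_natCast] at h
      calc _ = ((n + 1).factorial : ℝ) * ‖φ (D a)‖ ^ (n + 1) := by ring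
        _ ≤ C * (K ^ (n + 1) * p a ^ (n + 1)) := h.trans (mul_le_mul_of_nonneg_left
            ((hiter _ _).trans (mul_le_mul_of_nonneg_left (nestedPow_le p hp a n)
              (by positivity))) hC0)
        _ = _ := by rw [mul_pow]
    have hpos : 0 < ‖φ (D a)‖ := norm_pos_iff.2 hne
    have hlim : Tendsto (fun n : ℕ => C * ((K * p a / ‖φ (D a)‖) ^ (n + 1) / (n + 1).factorial))
        atTop (𝓝 (C * 0)) :=
      ((tendsto_add_atTop_iff_nat 1).2
        (FloorSemiring.tendsto_pow_div_factorial_atTop (K * p a / ‖φ (D a)‖))).const_mul C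
    have hge : ∀ n : ℕ, 1 ≤ C * ((K * p a / ‖φ (D a)‖) ^ (n + 1) / (n + 1).factorial) := by
      intro n
      have h := hb n
      rw [← div_le_div_iff_of_pos_right (c := ‖φ (D a)‖ ^ (n + 1)) (by positivity),
        div_self (by positivity)] at h
      rw [div_pow]
      refine h.trans (le_of_eq ?_)
      field_simp
    have := ge_of_tendsto' hlim hge
    norm_num at this
  by_cases ha : φ a = 0
  · exact key a ha
  -- Reduction to the kernel of φ: D sends this element to one on which φ equals −φ(a) φ(Da).
  · have h1 : φ (φ a • a - a * a) = 0 := by simp [hφ]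
    have h2 := key _ h1
    rw [map_sub, map_sub, hD, map_add, hφ, hφ, map_smul, map_smul, smul_eq_mul] at h2
    have h3 : φ a * φ (D a) = 0 := by linear_combination -h2
    exact (mul_eq_zero.1 h3).resolve_left ha

end Derivation

/-! ### Fourier injectivity, weights and convolution on the half-line -/

open scoped FourierTransform in
/-- The Fourier transform is injective on integrable functions. -/
theorem ae_eq_zero_of_fourier_eq_zero {f : ℝ → ℂ} (hf : Integrable f)
    (h : ∀ ξ, 𝓕 f ξ = 0) : f =ᵐ[volume] 0 := by
  refine ae_eq_zero_of_integral_contDiff_smul_eq_zero hf.locallyIntegrable fun g hg hgs => ?_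
  have hgs' : HasCompactSupport (fun x => (g x : ℂ)) := hgs.comp_left Complex.ofReal_zero
  let G : SchwartzMap ℝ ℂ := hgs'.toSchwartzMap (Complex.ofRealCLM.contDiff.comp hg)
  have hG : 𝓕 (𝓕⁻ G : SchwartzMap ℝ ℂ) = G := FourierTransform.fourier_fourierInv_eq G
  -- Each test function is the Fourier transform of a Schwartz function, so self-adjointness moves
  -- the transform onto `f`, where it vanishes.
  have hadj : ∫ ξ, 𝓕 f ξ • (𝓕⁻ G : SchwartzMap ℝ ℂ) ξ
      = ∫ x, f x • 𝓕 ((𝓕⁻ G : SchwartzMap ℝ ℂ) : ℝ → ℂ) x := by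
    simpa using! VectorFourier.integral_fourierIntegral_smul_eq_flip (L := innerₗ ℝ)
      Real.continuous_fourierChar continuous_inner hf (𝓕⁻ G : SchwartzMap ℝ ℂ).integrable
  rw [← SchwartzMap.fourier_coe, hG] at hadj
  simp only [h, zero_smul, integral_zero] at hadj
  rw [hadj]
  refine integral_congr_ae (Eventually.of_forall fun x => ?_)
  change g x • f x = f x * (g x : ℂ)
  rw [Complex.real_smul, mul_comm]

/-- An algebra weight tending to infinity is bounded below by a positive constant. -/
theorem IsAlgebraWeight.exists_one_le_mul {w : ℝ → ℝ} (hw : IsAlgebraWeight w)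
    (h : Tendsto w atTop atTop) : ∃ C : ℝ, 0 < C ∧ ∀ t, 0 ≤ t → 1 ≤ C * w t := by
  obtain ⟨T, hT⟩ := eventually_atTop.1 (h.eventually_ge_atTop 1)
  obtain ⟨B, hB⟩ := hw.inv_locallyBounded T
  refine ⟨max B 1, by positivity, fun t ht => ?_⟩
  have hpos := hw.pos t ht
  rcases le_total t T with htT | htT
  · have := (hB (mem_image_of_mem _ ⟨ht, htT⟩)).trans (le_max_left B 1)
    exact (div_le_iff₀ hpos).1 this
  · exact (hT t htT).trans (le_mul_of_one_le_left hpos.le (le_max_right B 1))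

theorem norm_convPos_mul_le {w : ℝ → ℝ} (hw : IsAlgebraWeight w) (f g : ℝ → ℂ) {t : ℝ}
    (ht : 0 ≤ t) (hint : IntervalIntegrable
      (fun s => ‖f s‖ * w s * (‖g (t - s)‖ * w (t - s))) volume 0 t) :
    ‖convPos f g t‖ * w t ≤ ∫ s in (0 : ℝ)..t, ‖f s‖ * w s * (‖g (t - s)‖ * w (t - s)) := by
  rw [convPos]
  refine (mul_le_mul_of_nonneg_right (intervalIntegral.norm_integral_le_integral_norm ht)
    (hw.pos t ht).le).trans ?_
  rw [← intervalIntegral.integral_mul_const]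
  rw [intervalIntegral.integral_of_le ht, intervalIntegral.integral_of_le ht]
  refine integral_mono_of_nonneg (Eventually.of_forall fun s => ?_)
    ((intervalIntegrable_iff_integrableOn_Ioc_of_le ht).1 hint) ?_
  · have := hw.pos t ht
    positivity
  · filter_upwards [ae_restrict_mem measurableSet_Ioc] with s hs
    have h3 : w t ≤ w s * w (t - s) := by simpa using hw.submul s (t - s) hs.1.le (sub_nonneg.2 hs.2)
    rw [norm_mul]
    calc ‖f s‖ * ‖g (t - s)‖ * w t ≤ ‖f s‖ * ‖g (t - s)‖ * (w s * w (t - s)) := by gcongr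
      _ = ‖f s‖ * w s * (‖g (t - s)‖ * w (t - s)) := by ring

/-- Fubini for the extensions by zero; it supplies the integrability that `norm_convPos_mul_le`
requires at almost every t. -/
theorem ae_intervalIntegrable_posConvolution {f g : ℝ → ℝ} (hf : Integrable f volPos)
    (hg : Integrable g volPos) :
    ∀ᵐ t ∂volPos, IntervalIntegrable (fun s => f s * g (t - s)) volume 0 t := by
  rw [volPos_eq] at *
  have hex := ((integrable_indicator_iff measurableSet_Ioi).2 hf).ae_convolution_exists
    (μ := volume) (ContinuousLinearMap.mul ℝ ℝ) ((integrable_indicator_iff measurableSet_Ioi).2 hg)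
  filter_upwards [ae_restrict_mem measurableSet_Ioi, ae_restrict_of_ae hex] with t ht htex
  rw [intervalIntegrable_iff_integrableOn_Ioo_of_le (le_of_lt ht)]
  have h2 : IntegrableOn (fun s => (ContinuousLinearMap.mul ℝ ℝ)
      ((Ioi (0 : ℝ)).indicator f s) ((Ioi (0 : ℝ)).indicator g (t - s))) (Ioo 0 t) volume :=
    Integrable.integrableOn htex
  refine h2.congr_fun ?_ measurableSet_Ioo
  intro s hs
  have h3 : t - s ∈ Ioi (0 : ℝ) := sub_pos.2 hs.2
  simp only [indicator_of_mem (show s ∈ Ioi (0 : ℝ) from hs.1), indicator_of_mem h3,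
    ContinuousLinearMap.mul_apply']

/-! ### Submultiplicativity of the norms -/

namespace FrechetA

variable {ω : WeightSequence}

theorem withSeminorms_norms (ω : WeightSequence) : WithSeminorms (norms ω) := ⟨rfl⟩

theorem norms_apply (n : ℕ) (f : FrechetA ω) :
    norms ω n f = ∫ t in Ici (0 : ℝ), ‖f.toAEEqFun t‖ * ω.weight n t := rfl

theorem coeFn_add (f g : FrechetA ω) :
    (f + g).toAEEqFun =ᵐ[volPos] f.toAEEqFun + g.toAEEqFun :=
  AEEqFun.coeFn_add f.toAEEqFun g.toAEEqFun

theorem coeFn_smul (c : ℂ) (f : FrechetA ω) :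
    (c • f).toAEEqFun =ᵐ[volPos] c • ⇑f.toAEEqFun :=
  AEEqFun.coeFn_smul c f.toAEEqFun

theorem coeFn_mul (f g : FrechetA ω) :
    (f * g).toAEEqFun =ᵐ[volPos] convPos f.toAEEqFun g.toAEEqFun :=
  AEEqFun.coeFn_mk _ (aestronglyMeasurable_convPos f.toAEEqFun.aestronglyMeasurable
    g.toAEEqFun.aestronglyMeasurable)

theorem norms_mono : Monotone (norms ω) := by
  refine monotone_nat_of_le_succ fun n f => ?_
  refine integral_mono_ae (f.integrable_norm n) (f.integrable_norm (n + 1)) ?_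
  filter_upwards [ae_restrict_mem measurableSet_Ici] with t ht
  exact mul_le_mul_of_nonneg_left (ω.increasing n t ht) (norm_nonneg _)

/-- By w(t) ≤ w(s) w(t − s), the weighted product is dominated by the convolution of |f|w and |g|w,
whose integral is the product of their integrals. -/
theorem norms_mul_le (n : ℕ) (f g : FrechetA ω) :
    norms ω n (f * g) ≤ norms ω n f * norms ω n g := by
  have hw := ω.isAlgebraWeight n
  have hsub : Ioi (0 : ℝ) ⊆ Ici 0 := Ioi_subset_Ici_self
  have hF := IntegrableOn.mono_set (f.integrable_norm n) hsub
  have hG := IntegrableOn.mono_set (g.integrable_norm n) hsub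
  have hae := ae_restrict_of_ae_restrict_of_subset hsub
    (ae_intervalIntegrable_posConvolution (f.integrable_norm n) (g.integrable_norm n))
  have hfg := IntegrableOn.mono_set ((f * g).integrable_norm n) hsub
  have hmul := ae_restrict_of_ae_restrict_of_subset hsub (coeFn_mul f g)
  rw [norms_apply, norms_apply, norms_apply, integral_Ici_eq_integral_Ioi,
    integral_Ici_eq_integral_Ioi, integral_Ici_eq_integral_Ioi]
  have hprod := integral_posConvolution hF hG (ContinuousLinearMap.mul ℝ ℝ)
  have hint := (integrable_posConvolution (μ := volume) (ν := volume) hF hG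
    (ContinuousLinearMap.mul ℝ ℝ)).mono_measure
      (Measure.restrict_le_self (s := Ioi (0 : ℝ)))
  simp only [ContinuousLinearMap.mul_apply'] at hprod
  rw [← hprod]
  refine integral_mono_ae hfg (hint.congr ?_) ?_
  · filter_upwards [ae_restrict_mem measurableSet_Ioi] with t ht
    rw [posConvolution, indicator_of_mem ht]
    rfl
  · filter_upwards [hae, hmul, ae_restrict_mem measurableSet_Ioi] with t ht hm h0
    rw [hm]
    exact norm_convPos_mul_le hw _ _ (le_of_lt h0) ht

/-! ### From weak compactness to boundedness in one norm -/

/-- Multiplication by the `n`-th weight, as a map from `A(ω)` to `L¹`. -/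
noncomputable def toL1 (ω : WeightSequence) (n : ℕ) :
    FrechetA ω →ₗ[ℂ] Lp ℂ 1 volPos where
  toFun f := (f.integrable n).toL1 _
  map_add' f g := by
    rw [← Integrable.toL1_add]
    refine (Integrable.toL1_eq_toL1_iff _ _ _ _).2 ?_
    filter_upwards [coeFn_add f g] with t ht
    simp [ht, add_mul]
  map_smul' c f := by
    rw [RingHom.id_apply, ← Integrable.toL1_smul]
    refine (Integrable.toL1_eq_toL1_iff _ _ _ _).2 ?_
    filter_upwards [coeFn_smul c f] with t ht
    simp [ht, mul_assoc]

theorem norm_toL1 (n : ℕ) (f : FrechetA ω) : ‖toL1 ω n f‖ = norms ω n f := by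
  rw [norms_apply]
  refine (L1.norm_of_fun_eq_integral_norm (f.integrable n)).trans (integral_congr_ae ?_)
  filter_upwards [ae_restrict_mem measurableSet_Ici] with t ht
  rw [norm_mul, Complex.norm_real, Real.norm_of_nonneg ((ω.isAlgebraWeight n).pos t ht).le]

theorem continuous_toL1 (n : ℕ) : Continuous (toL1 ω n) := by
  refine WithSeminorms.continuous_normedSpace_rng _ (withSeminorms_norms ω) _ ⟨{n}, 1, fun f => ?_⟩
  simp [norm_toL1]

/-- Weakly relatively compact subsets of `A(ω)` are bounded. -/
theorem bddAbove_norms_of_isCompact_closure {S : Set (FrechetA ω)}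
    (hS : IsCompact (closure (toWeakSpace ℂ (FrechetA ω) '' S))) (n : ℕ) :
    ∃ C, ∀ f ∈ S, norms ω n f ≤ C := by
  let T : FrechetA ω →L[ℂ] Lp ℂ 1 volPos := ⟨toL1 ω n, continuous_toL1 n⟩
  -- Uniform boundedness in the bidual of L¹: each functional pulls back to a weakly continuous one,
  -- hence is bounded on the compact closure.
  obtain ⟨C, hC⟩ := banach_steinhaus
    (g := fun f : S => NormedSpace.inclusionInDoubleDual ℂ (Lp ℂ 1 volPos) (T f)) (by
      intro l
      have hcont : Continuous fun x : WeakSpace ℂ (FrechetA ω) => (l.comp T)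
          ((toWeakSpace ℂ (FrechetA ω)).symm x) :=
        WeakBilin.eval_continuous _ (l.comp T)
      obtain ⟨C, hC⟩ := (hS.image hcont).isBounded.exists_norm_le
      exact ⟨C, fun f => hC _ ⟨_, subset_closure ⟨f, f.2, rfl⟩, by simp⟩⟩)
  refine ⟨C, fun f hf => ?_⟩
  have h := hC ⟨f, hf⟩
  rw [← norm_toL1]
  exact ((NormedSpace.inclusionInDoubleDualLi ℂ (E := Lp ℂ 1 volPos)).norm_map (T f)).symm.trans_le h

/-- A weakly compact linear map is bounded with respect to one of the norms of `A(ω)`. -/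
theorem exists_norms_le_of_isWeaklyCompactMap {D : FrechetA ω →ₗ[ℂ] FrechetA ω}
    (hD : IsWeaklyCompactMap D) :
    ∃ (n : ℕ) (K : ℝ), ∀ f, norms ω n (D f) ≤ K * norms ω n f := by
  obtain ⟨U, hU, hc⟩ := hD
  obtain ⟨s, r, hr, hs⟩ := ((withSeminorms_norms ω).mem_nhds_iff 0 U).1 hU
  obtain ⟨n, hn⟩ : ∃ n, s.sup (norms ω) ≤ norms ω n :=
    ⟨s.sup id, Finset.sup_le fun i hi => norms_mono (Finset.le_sup (f := id) hi)⟩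
  -- The index is the one of the ball inside `U`, so that D is bounded from ‖·‖ₙ to itself and can
  -- be iterated.
  obtain ⟨C, hC⟩ := bddAbove_norms_of_isCompact_closure hc n
  have hC' : ∀ f, norms ω n f < r → norms ω n (D f) ≤ C := fun f hf =>
    hC _ (mem_image_of_mem _ (hs (by
      rw [Seminorm.mem_ball, sub_zero]
      exact (hn f).trans_lt hf)))
  have hC0 : 0 ≤ C := by simpa using hC' 0 (by simpa using hr)
  refine ⟨n, C / (r / 2), fun f => ?_⟩
  -- Rescaling to norm at most r/2 stays inside the open ball; ε avoids division by zero and is then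
  -- sent to 0.
  have key : ∀ ε > 0, norms ω n (D f) ≤ C / (r / 2) * (norms ω n f + ε) := by
    intro ε hε
    have hp : 0 < norms ω n f + ε := by positivity
    set c : ℝ := r / 2 / (norms ω n f + ε) with hc
    have hcpos : 0 < c := by positivity
    have h1 := hC' ((c : ℂ) • f) (by
      rw [map_smul_eq_mul, Complex.norm_real, Real.norm_of_nonneg hcpos.le]
      calc c * norms ω n f ≤ c * (norms ω n f + ε) := by gcongr; linarith
        _ = r / 2 := by rw [hc]; field_simp
        _ < r := by linarith)
    rw [map_smul, map_smul_eq_mul, Complex.norm_real, Real.norm_of_nonneg hcpos.le, mul_comm,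
      ← le_div_iff₀ hcpos] at h1
    refine h1.trans (le_of_eq ?_)
    rw [hc]
    field_simp
  have hlim : Tendsto (fun ε => C / (r / 2) * (norms ω n f + ε)) (𝓝[>] 0)
      (𝓝 (C / (r / 2) * (norms ω n f + 0))) :=
    (Continuous.tendsto (by fun_prop) 0).mono_left nhdsWithin_le_nhds
  rw [add_zero] at hlim
  exact ge_of_tendsto hlim (eventually_nhdsWithin_of_forall key)

/-! ### Fourier transforms as characters of the algebra -/

theorem integrable_toAEEqFun (f : FrechetA ω) : Integrable f.toAEEqFun volPos := by
  obtain ⟨C, -, hC⟩ := (ω.isAlgebraWeight 0).exists_one_le_mul (ω.tendsto_atTop 0)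
  refine ((f.integrable_norm 0).const_mul C).mono' f.toAEEqFun.aestronglyMeasurable ?_
  filter_upwards [ae_restrict_mem measurableSet_Ici] with t ht
  nlinarith [hC t ht, norm_nonneg (f.toAEEqFun t)]

theorem integrable_fourierChar_mul (ξ : ℝ) (f : FrechetA ω) :
    Integrable (fun t => (Real.fourierChar (-(t * ξ)) : ℂ) * f.toAEEqFun t) volPos := by
  refine f.integrable_toAEEqFun.bdd_mul (c := 1) ?_ 
    (Eventually.of_forall fun t => (Circle.norm_coe _).le)
  exact Continuous.aestronglyMeasurable (by
    have := Real.continuous_fourierChar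
    fun_prop)

/-- The Fourier transform at `ξ`, as a functional on `A(ω)`. -/
noncomputable def fourierFunctional (ω : WeightSequence) (ξ : ℝ) : FrechetA ω →ₗ[ℂ] ℂ where
  toFun f := ∫ t in Ici (0 : ℝ), (Real.fourierChar (-(t * ξ)) : ℂ) * f.toAEEqFun t
  map_add' f g := by
    rw [← integral_add (f.integrable_fourierChar_mul ξ) (g.integrable_fourierChar_mul ξ)]
    refine integral_congr_ae ?_
    filter_upwards [coeFn_add f g] with t ht
    simp [ht, mul_add]
  map_smul' c f := by
    rw [RingHom.id_apply, smul_eq_mul, ← integral_const_mul]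
    refine integral_congr_ae ?_
    filter_upwards [coeFn_smul c f] with t ht
    simp only [ht, Pi.smul_apply, smul_eq_mul]
    ring

theorem fourierFunctional_apply (ξ : ℝ) (f : FrechetA ω) : fourierFunctional ω ξ f =
    ∫ t in Ici (0 : ℝ), (Real.fourierChar (-(t * ξ)) : ℂ) * f.toAEEqFun t := rfl

/-- The exponential at t splits as its values at s and t − s, so twisting by it commutes with
convolution, and the integral of a convolution is the product of the integrals. -/
theorem fourierFunctional_mul (ξ : ℝ) (f g : FrechetA ω) :
    fourierFunctional ω ξ (f * g) = fourierFunctional ω ξ f * fourierFunctional ω ξ g := by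
  have hsub : Ioi (0 : ℝ) ⊆ Ici 0 := Ioi_subset_Ici_self
  have hF := IntegrableOn.mono_set (f.integrable_fourierChar_mul ξ) hsub
  have hG := IntegrableOn.mono_set (g.integrable_fourierChar_mul ξ) hsub
  have hmul := ae_restrict_of_ae_restrict_of_subset hsub (coeFn_mul f g)
  simp only [fourierFunctional_apply, integral_Ici_eq_integral_Ioi]
  refine Eq.trans (integral_congr_ae ?_)
    (integral_posConvolution hF hG (ContinuousLinearMap.mul ℝ ℂ))
  filter_upwards [hmul] with t ht
  rw [ht, convPos, ← intervalIntegral.integral_const_mul]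
  refine intervalIntegral.integral_congr fun s _ => ?_
  have h : Real.fourierChar (-(t * ξ)) =
      Real.fourierChar (-(s * ξ)) * Real.fourierChar (-((t - s) * ξ)) := by
    rw [← AddChar.map_add_eq_mul]
    congr 1
    ring
  simp only [h, ContinuousLinearMap.mul_apply', Circle.coe_mul]
  ring

/-- The exponential has modulus 1 and ωₙ is bounded below, so every single norm, in particular the
one controlling D, dominates the transform. -/
theorem norm_fourierFunctional_le (ω : WeightSequence) (n : ℕ) :
    ∃ C : ℝ, ∀ ξ f, ‖fourierFunctional ω ξ f‖ ≤ C * norms ω n f := by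
  obtain ⟨C, -, hC⟩ := (ω.isAlgebraWeight n).exists_one_le_mul (ω.tendsto_atTop n)
  refine ⟨C, fun ξ f => ?_⟩
  rw [fourierFunctional_apply, norms_apply, ← integral_const_mul]
  refine norm_integral_le_of_norm_le ((f.integrable_norm n).const_mul C) ?_
  filter_upwards [ae_restrict_mem measurableSet_Ici] with t ht
  rw [norm_mul, Circle.norm_coe, one_mul]
  nlinarith [hC t ht, norm_nonneg (f.toAEEqFun t)]

/-- The functionals give the Fourier transform on the line of the extension by zero, which is
integrable. -/
theorem eq_zero_of_fourierFunctional_eq_zero {f : FrechetA ω}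
    (h : ∀ ξ, fourierFunctional ω ξ f = 0) : f = 0 := by
  have hint := (integrable_indicator_iff measurableSet_Ici).2 f.integrable_toAEEqFun
  have hzero := ae_eq_zero_of_fourier_eq_zero hint (by
    intro ξ
    rw [Real.fourier_real_eq, ← h ξ, fourierFunctional_apply,
      ← integral_indicator measurableSet_Ici]
    congr 1 with t
    by_cases ht : t ∈ Ici (0 : ℝ) <;> simp [ht, indicator, Circle.smul_def])
  have : f.toAEEqFun = 0 := by
    refine AEEqFun.ext ?_
    filter_upwards [ae_restrict_of_ae hzero, ae_restrict_mem measurableSet_Ici,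
      AEEqFun.coeFn_zero (α := ℝ) (β := ℂ) (μ := volPos)] with t ht h0 hz
    rw [indicator_of_mem h0] at ht
    rw [ht, hz]
  exact Subtype.ext this

end FrechetA

theorem mainTheorem4 (ω : WeightSequence) (D : FrechetA ω →ₗ[ℂ] FrechetA ω)
    (hD : IsDerivation D) (hc : IsWeaklyCompactMap D) : D = 0 := by
  obtain ⟨n, K, hK⟩ := FrechetA.exists_norms_le_of_isWeaklyCompactMap hc
  obtain ⟨C, hC⟩ := FrechetA.norm_fourierFunctional_le ω n
  refine LinearMap.ext fun f => FrechetA.eq_zero_of_fourierFunctional_eq_zero fun ξ => ?_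
  exact hD.map_apply_eq_zero (FrechetA.fourierFunctional_mul ξ) (FrechetA.norms ω n)
    (FrechetA.norms_mul_le n) hK (hC ξ) f
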